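/- A \emph{continuum} is a non-empty connected compact metric space; a topological space $X$ has the \emph{fixed point property} if every continuous function $X\to X$ has a fixed point. A \emph{polyhedron} is the union of the simplices of a finite (geometric) simplicial complex in a Euclidean space. For an inverse sequence $\{P_\ell,f_\ell\}_{\ell=1}^{\infty}$ of spaces and functions $f_\ell:P_{\ell+1}\to P_\ell$, let $\varprojlim\{P_\ell,f_\ell\}_{\ell=1}^{\infty}$ be the subspace of $\prod_{\ell=1}^\infty P_\ell$ consisting of all $(x_1,x_2,\ldots)$ with $x_\ell=f_\ell(x_{\ell+1})$ for each $\ell$, let $p_n:\varprojlim\{P_\ell,f_\ell\}_{\ell=1}^{\infty}\to P_n$ be the $n$-th projection, and for positive integers $n\le m$ let $f_{n,m}=f_n\circ f_{n+1}\circ\cdots\circ f_{m-1}:P_m\to P_n$ (so that $f_{n,n}$ is the identity). For a function $g:\varprojlim\{P_\ell,f_\ell\}_{\ell=1}^{\infty}\to\varprojlim\{P_\ell,f_\ell\}_{\ell=1}^{\infty}$ let $T_{n,m}(g)(x)=p_n(g(p_m^{-1}(x)))\subseteq P_n$ for each $x\in P_m$. Let $\mathcal W=\{(n,m)\in\mathbb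 N\times\mathbb N \mid n\le m\}$, where $\mathbb N$ is the set of positive integers. \textbf{Theorem.} Let $X$ be any continuum. The following statements are equivalent. \begin{enumerate} \item $X$ does not have the fixed point property. \item There is an inverse sequence $\{P_\ell,f_\ell\}_{\ell=1}^{\infty}$ of connected polyhedra $P_\ell$ and continuous surjections $f_\ell:P_{\ell+1}\to P_\ell$ such that $\varprojlim\{P_\ell,f_\ell\}_{\ell=1}^{\infty}$ is homeomorphic to $X$, and there is a continuous function $g:\varprojlim\{P_\ell,f_\ell\}_{\ell=1}^{\infty}\to\varprojlim\{P_\ell,f_\ell\}_{\ell=1}^{\infty}$ such that there exists $(n,m)\in\mathcal W$ such that $f_{n,m}(x)\notin T_{n,m}(g)(x)$ holds for each $x\in P_m$. \item There is an inverse sequence $\{P_\ell,f_\ell\}_{\ell=1}^{\infty}$ of connected polyhedra $P_\ell$ and continuous surjections $f_\ell:P_{\ell+1}\to P_\ell$ such that $\varprojlim\{P_\ell,f_\ell\}_{\ell=1}^{\infty}$ is homeomorphic to $X$, and there is a continuous function $g:\varprojlim\{P_\ell,f_\ell\}_{\ell=1}^{\infty}\to\varprojlim\{P_\ell,f_\ell\}_{\ell=1}^{\infty}$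 such that for each $(n,m)\in\mathcal W$, $f_{n,m}(x)\notin T_{n,m}(g)(x)$ holds for each $x\in P_m$. \end{enumerate} -/

import Mathlib

/-- A topological space has the fixed point property if every continuous self-map has a
fixed point. -/
def HasFixedPointProperty (X : Type*) [TopologicalSpace X] : Prop :=
  ∀ f : X → X, Continuous f → ∃ p : X, f p = p

/-- A polyhedron: the union of the simplices of a finite geometric simplicial complex
in a Euclidean space. -/
def IsPolyhedron {d : ℕ} (P : Set (EuclideanSpace ℝ (Fin d))) : Prop :=
  ∃ K : Geometry.SimplicialComplex ℝ (EuclideanSpace ℝ (Fin d)), K.faces.Finite ∧ K.space = P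

section InverseSequence

/-- The inverse limit of the inverse sequence `X 0 ← X 1 ← X 2 ← ⋯` with bonding functions `f`,
as a subspace of the product. The sequence is indexed from `0` instead of `1`. -/
def inverseLimit {X : ℕ → Type*} (f : ∀ l, X (l + 1) → X l) : Set (∀ l, X l) :=
  {x | ∀ l, x l = f l (x (l + 1))}

/-- The `n`-th standard projection of the inverse limit. -/
def inverseLimitProj {X : ℕ → Type*} (f : ∀ l, X (l + 1) → X l) (n : ℕ) (x : inverseLimit f) :
    X n :=
  x.1 n

/-- The composition `f_{n,m} = f_n ∘ f_{n+1} ∘ ⋯ ∘ f_{m-1} : X_m → X_n` for `n ≤ m`, where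
`f_{n,n}` is the identity. -/
def bondingMap {X : ℕ → Type*} (f : ∀ l, X (l + 1) → X l) {n m : ℕ} (h : n ≤ m) : X m → X n :=
  Nat.leRec (motive := fun k _ => X k → X n) id (fun k _ F => F ∘ f k) h

theorem bondingMap_self {X : ℕ → Type*} (f : ∀ l, X (l + 1) → X l) (n : ℕ) :
    bondingMap f (le_refl n) = id := by
  simp [bondingMap]

theorem bondingMap_succ {X : ℕ → Type*} (f : ∀ l, X (l + 1) → X l) {n m : ℕ} (h : n ≤ m) :
    bondingMap f (Nat.le_succ_of_le h) = bondingMap f h ∘ f m := by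
  unfold bondingMap
  exact Nat.leRec_succ _ _ h

/-- The transformation `T_{n,m}(g) : X_m ⊸ Y_n` of a function `g` between inverse limits, the
set-valued function `T_{n,m}(g)(x) = q_n (g (p_m⁻¹ (x)))`. -/
def transformation {X Y : ℕ → Type*} (f : ∀ l, X (l + 1) → X l) (f' : ∀ l, Y (l + 1) → Y l)
    (g : inverseLimit f → inverseLimit f') (n m : ℕ) (x : X m) : Set (Y n) :=
  inverseLimitProj f' n '' (g '' (inverseLimitProj f m ⁻¹' {x}))

end InverseSequence

/-- An inverse sequence of connected polyhedra (each in some Euclidean space) with continuous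
surjective bonding functions. Note that `IsConnected` includes non-emptiness. -/
structure PolyhedralInverseSequence where
  dim : ℕ → ℕ
  P : ∀ l, Set (EuclideanSpace ℝ (Fin (dim l)))
  isPolyhedron : ∀ l, IsPolyhedron (P l)
  isConnected : ∀ l, IsConnected (P l)
  f : ∀ l, P (l + 1) → P l
  continuous_f : ∀ l, Continuous (f l)
  surjective_f : ∀ l, Function.Surjective (f l)

namespace PolyhedralInverseSequence

/-- The inverse limit of an inverse sequence of polyhedra, with the subspace topology of the
product. -/
abbrev limit (S : PolyhedralInverseSequence) : Set (∀ l, S.P l) :=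
  inverseLimit (X := fun l => S.P l) S.f

/-- The composed bonding function `f_{n,m} : P_m → P_n` for `n ≤ m`. -/
abbrev bond (S : PolyhedralInverseSequence) {n m : ℕ} (h : n ≤ m) : S.P m → S.P n :=
  bondingMap (X := fun l => S.P l) S.f h

/-- The transformation `T_{n,m}(g) : P_m ⊸ P_n` of a self-map `g` of the inverse limit. -/
abbrev T (S : PolyhedralInverseSequence) (n m : ℕ) (g : S.limit → S.limit) (x : S.P m) :
    Set (S.P n) :=
  transformation (X := fun l => S.P l) (Y := fun l => S.P l) S.f S.f g n m x

end PolyhedralInverseSequence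

/-! Since `bondingMap` carries the m-th projection to the n-th, some x has f_{n,m}(x) in
T_{n,m}(g)(x) exactly when some p in the limit satisfies p_n(g(p)) = p_n(p). So (2) says that, for
one n, the maps p_n ∘ g and p_n never agree, and a fixed point of g would contradict this.

For (1) → (3), a fixed-point-free map of a compact X moves every point by at least some ε > 0. It
suffices to write X as a limit in which every projection separates points at distance at least ε
(`exists_polyhedralInverseSequence`): then no projection identifies a point with its image.

The polyhedra are nerves of covers by small balls. A partition of unity maps X to the nerve, and
adding space-filling curves near finitely many points makes this map onto
(`exists_modification_covering_convex`). Such a map factors up to small error through finer nerves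
(`exists_approximate_factorization`). If the errors decrease fast enough relative to how well each
stage separates points, the approximate system converges to a homeomorphism onto the limit
(`exists_homeomorph_inverseLimit`). -/

section

open Set Metric Filter Topology

/-! ### Covering convex sets by small modifications of a map -/

/-- Every nonempty compact convex set in a Euclidean space is covered by a path inside it. -/
theorem exists_curve_onto_convex {d : ℕ} {C : Set (EuclideanSpace ℝ (Fin d))}
    (hC : IsCompact C) (hconv : Convex ℝ C) (hne : C.Nonempty) :
    ∃ c : ℝ → EuclideanSpace ℝ (Fin d), Continuous c ∧ (∀ t, c t ∈ C) ∧ C ⊆ c '' Icc 0 1 := by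
  -- The nearest-point projection, given by its variational inequality; it retracts the Tietze
  -- extension below back into `C`.
  obtain ⟨π, hπ⟩ : ∃ π : EuclideanSpace ℝ (Fin d) → EuclideanSpace ℝ (Fin d),
      ∀ u, π u ∈ C ∧ ∀ w ∈ C, inner ℝ (u - π u) (w - π u) ≤ 0 := by
    have (u : EuclideanSpace ℝ (Fin d)) :
        ∃ v, v ∈ C ∧ ∀ w ∈ C, inner ℝ (u - v) (w - v) ≤ 0 := by
      obtain ⟨v, hv, h⟩ := exists_norm_eq_iInf_of_complete_convex hne hC.isComplete hconv u
      exact ⟨v, hv, (norm_eq_iInf_iff_real_inner_le_zero hconv hv).1 h⟩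
    choose π hπ using this
    exact ⟨π, hπ⟩
  have hπC : ∀ u ∈ C, π u = u := by
    intro u hu
    have h := (hπ u).2 u hu
    rw [real_inner_self_eq_norm_sq] at h
    have h0 : ‖u - π u‖ = 0 := by nlinarith [norm_nonneg (u - π u)]
    exact (sub_eq_zero.1 (norm_eq_zero.1 h0)).symm
  have hπlip : LipschitzWith 1 π := by
    refine LipschitzWith.of_dist_le_mul fun u v => ?_
    rw [NNReal.coe_one, one_mul, dist_eq_norm, dist_eq_norm]
    have h1 := (hπ u).2 _ (hπ v).1
    have h2 := (hπ v).2 _ (hπ u).1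
    have h3 : ‖π u - π v‖ ^ 2 ≤ inner ℝ (u - v) (π u - π v) := by
      rw [← real_inner_self_eq_norm_sq]
      have e : inner ℝ (u - v) (π u - π v) - inner ℝ (π u - π v) (π u - π v)
          = - inner ℝ (u - π u) (π v - π u) - inner ℝ (v - π v) (π u - π v) := by
        simp only [inner_sub_left, inner_sub_right]; ring
      linarith
    have h4 := real_inner_le_norm (u - v) (π u - π v)
    by_contra! hlt
    nlinarith [norm_nonneg (u - v), norm_nonneg (π u - π v)]
  have : Nonempty C := hne.to_subtype
  have : CompactSpace C := isCompact_iff_compactSpace.1 hC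
  obtain ⟨s, hs, hsurj⟩ := exists_nat_bool_continuous_surjective_of_compact C
  let F : C(cantorSet, EuclideanSpace ℝ (Fin d)) :=
    ⟨fun x => (s (cantorSetHomeomorphNatToBool x) : EuclideanSpace ℝ (Fin d)),
      continuous_subtype_val.comp (hs.comp cantorSetHomeomorphNatToBool.continuous)⟩
  have : TietzeExtension (EuclideanSpace ℝ (Fin d)) :=
    TietzeExtension.of_tvs ℝ
  obtain ⟨G, hG⟩ := F.exists_restrict_eq isClosed_cantorSet
  refine ⟨π ∘ G, hπlip.continuous.comp G.continuous, fun t => (hπ _).1, fun v hv => ?_⟩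
  obtain ⟨b, hb⟩ := hsurj ⟨v, hv⟩
  refine ⟨cantorSetHomeomorphNatToBool.symm b,
    cantorSet_subset_unitInterval (cantorSetHomeomorphNatToBool.symm b).2, ?_⟩
  have h := DFunLike.congr_fun hG (cantorSetHomeomorphNatToBool.symm b)
  have h' : G (cantorSetHomeomorphNatToBool.symm b) = v := by
    simpa [F, hb] using h
  simp [h', hπC v hv]

/-- A map from a nondegenerate connected metric space to a Euclidean space can be modified near
finitely many points so that its image covers prescribed compact convex sets. -/
theorem exists_modification_covering_convex {Y : Type*} [MetricSpace Y] [ConnectedSpace Y]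
    [Nontrivial Y] {d : ℕ} {f : Y → EuclideanSpace ℝ (Fin d)} (hf : Continuous f) (F : Finset Y)
    (C : Y → Set (EuclideanSpace ℝ (Fin d))) (hC : ∀ y, IsCompact (C y))
    (hconv : ∀ y, Convex ℝ (C y)) (hne : ∀ y, (C y).Nonempty) {ε : ℝ} (hε : 0 < ε) :
    ∃ g : Y → EuclideanSpace ℝ (Fin d), Continuous g ∧
      (∀ z, g z = f z ∨ ∃ y ∈ F, dist z y < ε ∧ ∃ w ∈ C y, g z ∈ segment ℝ (f z) w) ∧
      ∀ y ∈ F, C y ⊆ range g := by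
  classical
  choose c hc hcC hcsurj using fun y => exists_curve_onto_convex (hC y) (hconv y) (hne y)
  choose w hw using fun y : Y => exists_ne y
  -- The last condition makes the balls of radius 2δ about points of `F` disjoint; `hδw` makes the
  -- distance to `y` take every value in [0, δ].
  obtain ⟨δ, hδ, hδε, hδw, hδF⟩ : ∃ δ > 0, 2 * δ < ε ∧ (∀ y ∈ F, δ ≤ dist (w y) y) ∧
      ∀ y ∈ F, ∀ y' ∈ F, y ≠ y' → 4 * δ ≤ dist y y' := by
    have e1 : ∀ᶠ δ in 𝓝[>] (0 : ℝ), 2 * δ < ε := by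
      refine mem_nhdsWithin_of_mem_nhds ?_
      exact (continuous_const.mul continuous_id).continuousAt.eventually_lt
        continuousAt_const (by simpa using hε)
    have e2 : ∀ᶠ δ in 𝓝[>] (0 : ℝ), ∀ y ∈ F, δ ≤ dist (w y) y := by
      refine (Finset.eventually_all F).2 fun y _ => mem_nhdsWithin_of_mem_nhds ?_
      exact Iic_mem_nhds (dist_pos.2 (hw y))
    have e3 : ∀ᶠ δ in 𝓝[>] (0 : ℝ), ∀ y ∈ F, ∀ y' ∈ F, y ≠ y' → 4 * δ ≤ dist y y' := by
      refine (Finset.eventually_all F).2 fun y _ => (Finset.eventually_all F).2 fun y' _ => ?_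
      by_cases h : y = y'
      · simp [h]
      · have : ∀ᶠ δ in 𝓝[>] (0 : ℝ), 4 * δ < dist y y' := by
          refine mem_nhdsWithin_of_mem_nhds ?_
          exact (continuous_const.mul continuous_id).continuousAt.eventually_lt
            continuousAt_const (by simpa using h)
        exact this.mono fun δ hδ _ => hδ.le
    obtain ⟨δ, ⟨⟨h1, h2⟩, h3⟩, h4⟩ :=
      (((e1.and e2).and e3).and self_mem_nhdsWithin).exists
    exact ⟨δ, h4, h1, h2, h3⟩
  let l : ℝ → ℝ := fun t => max 0 (min 1 (2 - t))
  have hl0 : ∀ t, 0 ≤ l t := fun t => le_max_left _ _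
  have hl1 : ∀ t, l t ≤ 1 := fun t => max_le zero_le_one (min_le_left _ _)
  have hlz : ∀ t, 2 ≤ t → l t = 0 := fun t ht =>
    max_eq_left ((min_le_right _ _).trans (by linarith))
  have hlo : ∀ t, t ≤ 1 → l t = 1 := fun t ht => by
    simp only [l]; rw [min_eq_left (by linarith)]; simp
  have hlc : Continuous l := by fun_prop
  -- Within δ of `y` the new map follows the curve `c y`, with the rescaled distance as time;
  -- between δ and 2δ it interpolates back to `f`.
  let term : Y → Y → EuclideanSpace ℝ (Fin d) := fun y z =>
    l (dist z y / δ) • (c y (dist z y / δ) - f z)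
  have hterm0 : ∀ y z, 2 * δ ≤ dist z y → term y z = 0 := fun y z h => by
    simp only [term]
    rw [hlz _ ((le_div_iff₀ hδ).2 h), zero_smul]
  have hunique : ∀ y ∈ F, ∀ z, dist z y < 2 * δ → ∑ y' ∈ F, term y' z = term y z := by
    intro y hy z hz
    refine Finset.sum_eq_single_of_mem y hy fun y' hy' hne => hterm0 _ _ ?_
    have h1 := hδF y hy y' hy' hne.symm
    have h2 := dist_triangle_left y y' z
    linarith
  refine ⟨fun z => f z + ∑ y ∈ F, term y z, ?_, ?_, ?_⟩
  · refine hf.add (continuous_finsetSum _ fun y _ => ?_)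
    have hd : Continuous fun z => dist z y / δ := by fun_prop
    exact (hlc.comp hd).smul (((hc y).comp hd).sub hf)
  · intro z
    by_cases h : ∃ y ∈ F, dist z y < 2 * δ
    · obtain ⟨y, hy, hz⟩ := h
      refine Or.inr ⟨y, hy, hz.trans hδε, _, hcC y (dist z y / δ), ?_⟩
      simp only [hunique y hy z hz]
      rw [segment_eq_image']
      exact ⟨_, ⟨hl0 _, hl1 _⟩, rfl⟩
    · push Not at h
      left
      simp only
      rw [Finset.sum_eq_zero fun y hy => hterm0 y z (h y hy), add_zero]
  · intro y hy v hv
    obtain ⟨t, ht, rfl⟩ := hcsurj y hv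
    have hcont : Continuous fun z => dist z y := by fun_prop
    obtain ⟨z, hz⟩ := mem_range_of_exists_le_of_exists_ge hcont (c := t * δ)
      ⟨y, by simpa using mul_nonneg ht.1 hδ.le⟩
      ⟨w y, le_trans (by nlinarith [ht.2]) (hδw y hy)⟩
    change dist z y = t * δ at hz
    have hz' : dist z y / δ = t := by rw [hz]; field_simp
    refine ⟨z, ?_⟩
    have hz2 : dist z y < 2 * δ := by rw [hz]; nlinarith [ht.2]
    simp only [hunique y hy z hz2, term, hz', hlo t ht.2]
    simp

/-! ### Faces of the standard simplex and nerves as polyhedra -/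

/-- The face of the standard simplex spanned by the basis vectors with index in `s`. -/
def standardFace {d : ℕ} (s : Set (Fin d)) : Set (EuclideanSpace ℝ (Fin d)) :=
  {p | (∀ i, 0 ≤ p i) ∧ ∑ i, p i = 1 ∧ ∀ i, p i ≠ 0 → i ∈ s}

theorem standardFace_mono {d : ℕ} {s t : Set (Fin d)} (h : s ⊆ t) :
    standardFace s ⊆ standardFace t :=
  fun _ hp => ⟨hp.1, hp.2.1, fun i hi => h (hp.2.2 i hi)⟩

theorem single_mem_standardFace {d : ℕ} {s : Set (Fin d)} {i : Fin d} (hi : i ∈ s) :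
    EuclideanSpace.single i (1 : ℝ) ∈ standardFace s := by
  refine ⟨fun j => ?_, ?_, fun j hj => ?_⟩
  · simp only [PiLp.single_apply]; split_ifs <;> norm_num
  · simp [PiLp.single_apply]
  · by_contra h
    refine hj ?_
    rw [PiLp.single_apply, if_neg]
    rintro rfl
    exact h hi

theorem convex_standardFace {d : ℕ} (s : Set (Fin d)) : Convex ℝ (standardFace s) := by
  intro p hp q hq a b ha hb hab
  refine ⟨fun i => ?_, ?_, fun i hi => ?_⟩
  · have := hp.1 i
    have := hq.1 i
    simp only [PiLp.add_apply, PiLp.smul_apply, smul_eq_mul]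
    positivity
  · simp only [PiLp.add_apply, PiLp.smul_apply, smul_eq_mul, Finset.sum_add_distrib,
      ← Finset.mul_sum, hp.2.1, hq.2.1, mul_one, hab]
  · by_contra h
    have h1 : p i = 0 := by_contra fun h' => h (hp.2.2 i h')
    have h2 : q i = 0 := by_contra fun h' => h (hq.2.2 i h')
    simp [h1, h2] at hi

theorem convexHull_image_single {d : ℕ} (s : Set (Fin d)) :
    convexHull ℝ ((fun i => EuclideanSpace.single i (1 : ℝ)) '' s) = standardFace s := by
  classical
  apply Subset.antisymm
  · refine convexHull_min ?_ (convex_standardFace s)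
    rintro _ ⟨i, hi, rfl⟩
    exact single_mem_standardFace hi
  · intro p hp
    have hsum : ∑ i ∈ Finset.univ.filter (· ∈ s), p i = 1 := by
      rw [← hp.2.1]
      exact Finset.sum_subset (Finset.subset_univ _) fun i _ hi => by
        by_contra h
        exact hi (by simpa using hp.2.2 i h)
    have hrep : ∑ i ∈ Finset.univ.filter (· ∈ s), p i • EuclideanSpace.single i (1 : ℝ) = p := by
      ext j
      rw [WithLp.ofLp_sum, Finset.sum_apply]
      simp only [PiLp.smul_apply, PiLp.single_apply, smul_eq_mul, mul_ite, mul_one, mul_zero,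
        Finset.sum_ite_eq, Finset.mem_filter, Finset.mem_univ, true_and]
      split_ifs with h
      · rfl
      · exact (by_contra fun h' => h (hp.2.2 j fun h0 => h' h0.symm))
    rw [← hrep]
    refine (convex_convexHull ℝ _).sum_mem (fun i _ => hp.1 i) hsum fun i hi => ?_
    exact subset_convexHull ℝ _ ⟨i, by simpa using hi, rfl⟩

theorem isCompact_standardFace {d : ℕ} (s : Set (Fin d)) : IsCompact (standardFace s) := by
  rw [← convexHull_image_single]
  exact (s.toFinite.image _).isCompact_convexHull ℝ

theorem standardFace_inter {d : ℕ} (s t : Set (Fin d)) :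
    standardFace s ∩ standardFace t = standardFace (s ∩ t) := by
  ext p
  constructor
  · rintro ⟨hs, ht⟩
    exact ⟨hs.1, hs.2.1, fun i hi => ⟨hs.2.2 i hi, ht.2.2 i hi⟩⟩
  · exact fun h => ⟨standardFace_mono inter_subset_left h, standardFace_mono inter_subset_right h⟩

/-- The geometric realization, inside the standard simplex, of the nerve of a finite family. -/
def nerveSpace {A : Type*} {d : ℕ} (U : Fin d → Set A) : Set (EuclideanSpace ℝ (Fin d)) :=
  ⋃ x, standardFace {i | x ∈ U i}

theorem mem_nerveSpace {A : Type*} {d : ℕ} {U : Fin d → Set A} {p : EuclideanSpace ℝ (Fin d)} :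
    p ∈ nerveSpace U ↔ (∀ i, 0 ≤ p i) ∧ ∑ i, p i = 1 ∧ ∃ x, ∀ i, p i ≠ 0 → x ∈ U i := by
  simp only [nerveSpace, standardFace, mem_iUnion, mem_ofPred_eq]
  tauto

theorem isPolyhedron_nerveSpace {A : Type*} {d : ℕ} (U : Fin d → Set A) :
    IsPolyhedron (nerveSpace U) := by
  classical
  let e : Fin d → EuclideanSpace ℝ (Fin d) := fun i => EuclideanSpace.single i (1 : ℝ)
  have hlin : LinearIndependent ℝ e := by
    have h := (EuclideanSpace.basisFun (Fin d) ℝ).toBasis.linearIndependent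
    have he : e = (EuclideanSpace.basisFun (Fin d) ℝ).toBasis := by
      ext i; simp [e]
    rwa [he]
  have hinj : Function.Injective e := hlin.injective
  have hhull (σ : Finset (Fin d)) :
      convexHull ℝ (σ.image e : Set (EuclideanSpace ℝ (Fin d))) = standardFace (σ : Set (Fin d)) := by
    rw [Finset.coe_image]
    exact convexHull_image_single _
  let faces : Set (Finset (EuclideanSpace ℝ (Fin d))) :=
    {t | ∃ σ : Finset (Fin d), σ.Nonempty ∧ (∃ x, ∀ i ∈ σ, x ∈ U i) ∧ t = σ.image e}
  let K : Geometry.SimplicialComplex ℝ (EuclideanSpace ℝ (Fin d)) :=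
    { faces := faces
      isRelLowerSet_faces := by
        rintro t ⟨σ, hσ, ⟨x, hx⟩, rfl⟩
        refine ⟨hσ.image e, fun b hb hbne => ?_⟩
        obtain ⟨τ, hτ, rfl⟩ := Finset.subset_image_iff.1 hb
        exact ⟨τ, Finset.image_nonempty.1 hbne, ⟨x, fun i hi => hx i (hτ hi)⟩, rfl⟩
      indep := by
        rintro t ⟨σ, -, -, rfl⟩
        refine hlin.affineIndependent.range.mono ?_
        rw [Finset.coe_image]
        exact image_subset_range _ _
      inter_subset_convexHull := by
        rintro t t' ⟨σ, -, -, rfl⟩ ⟨τ, -, -, rfl⟩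
        rw [hhull, hhull, standardFace_inter, ← Finset.coe_inter, ← Finset.coe_inter,
          ← Finset.image_inter _ _ hinj, hhull] }
  refine ⟨K, ?_, ?_⟩
  · refine (finite_range fun σ : Finset (Fin d) => σ.image e).subset ?_
    rintro t ⟨σ, -, -, rfl⟩
    exact ⟨σ, rfl⟩
  · ext p
    rw [Geometry.SimplicialComplex.mem_space_iff]
    constructor
    · rintro ⟨t, ⟨σ, -, ⟨x, hx⟩, rfl⟩, hp⟩
      rw [hhull] at hp
      exact mem_iUnion.2 ⟨x, standardFace_mono (fun i hi => hx i hi) hp⟩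
    · intro hp
      obtain ⟨x, hx⟩ := mem_iUnion.1 hp
      refine ⟨(Finset.univ.filter fun i => x ∈ U i).image e, ⟨_, ?_, ⟨x, ?_⟩, rfl⟩, ?_⟩
      · by_contra h
        rw [Finset.not_nonempty_iff_eq_empty] at h
        have h1 := hx.2.1
        rw [Finset.sum_eq_zero fun i _ => by_contra fun h' =>
          by simpa [h] using Finset.mem_filter.2 ⟨Finset.mem_univ i, hx.2.2 i h'⟩] at h1
        exact zero_ne_one h1
      · simp
      · rw [hhull]
        simpa using hx

/-- The nerve space of a finite family is a neighborhood retract. -/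
theorem exists_retraction_nerveSpace {A : Type*} {d : ℕ} (U : Fin d → Set A) :
    ∃ (O : Set (EuclideanSpace ℝ (Fin d)))
      (ρ : EuclideanSpace ℝ (Fin d) → EuclideanSpace ℝ (Fin d)),
      IsOpen O ∧ nerveSpace U ⊆ O ∧ ContinuousOn ρ O ∧ (∀ p ∈ O, ρ p ∈ nerveSpace U) ∧
      ∀ p ∈ nerveSpace U, ρ p = p := by
  classical
  -- For nonempty σ, `m σ` vanishes as soon as one coordinate in σ does. The sum `t` over
  -- non-simplices is zero on the nerve. Off it, subtracting `t` from all coordinates leaves a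
  -- simplex as support: a non-simplex σ with all coordinates above `t` would give `m σ p > t p ≥ m
  -- σ p`.
  let m : Finset (Fin d) → EuclideanSpace ℝ (Fin d) → ℝ := fun σ p =>
    if h : σ.Nonempty then σ.inf' h fun i => |p i| else 0
  have hm : ∀ σ, Continuous (m σ) := by
    intro σ
    by_cases h : σ.Nonempty
    · simp only [m, h, dif_pos]
      exact Continuous.finset_inf'_apply h fun i _ => by fun_prop
    · simp only [m, h, dif_neg, not_false_iff]
      exact continuous_const
  have hm0 : ∀ σ p, 0 ≤ m σ p := by
    intro σ p
    by_cases h : σ.Nonempty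
    · simp only [m, h, dif_pos]
      exact Finset.le_inf' _ _ fun i _ => abs_nonneg _
    · simp [m, h]
  let N : Finset (Finset (Fin d)) := Finset.univ.filter fun σ => ¬ ∃ x, ∀ i ∈ σ, x ∈ U i
  let t : EuclideanSpace ℝ (Fin d) → ℝ := fun p => ∑ σ ∈ N, m σ p
  have ht : Continuous t := continuous_finsetSum _ fun σ _ => hm σ
  have ht0 : ∀ p, 0 ≤ t p := fun p => Finset.sum_nonneg fun σ _ => hm0 σ p
  let u : Fin d → EuclideanSpace ℝ (Fin d) → ℝ := fun i p => max 0 (p i - t p)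
  have hu : ∀ i, Continuous (u i) := fun i => by simp only [u]; fun_prop
  have hu0 : ∀ i p, 0 ≤ u i p := fun i p => le_max_left _ _
  let S : EuclideanSpace ℝ (Fin d) → ℝ := fun p => ∑ i, u i p
  have hS : Continuous S := continuous_finsetSum _ fun i _ => hu i
  have hfix : ∀ p ∈ nerveSpace U, t p = 0 := by
    intro p hp
    obtain ⟨hp0, -, x, hx⟩ := mem_nerveSpace.1 hp
    refine Finset.sum_eq_zero fun σ hσ => ?_
    by_cases h : σ.Nonempty
    · refine le_antisymm ?_ (hm0 σ p)
      simp only [N, Finset.mem_filter, Finset.mem_univ, true_and, not_exists, not_forall] at hσ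
      obtain ⟨i, hi, hxi⟩ := hσ x
      have hpi : p i = 0 := by_contra fun h' => hxi (hx i h')
      simp only [m, h, dif_pos]
      exact (Finset.inf'_le _ hi).trans (by simp [hpi])
    · simp [m, h]
  have hfixu : ∀ p ∈ nerveSpace U, ∀ i, u i p = p i := by
    intro p hp i
    simp only [u, hfix p hp, sub_zero]
    exact max_eq_right ((mem_nerveSpace.1 hp).1 i)
  have hfixS : ∀ p ∈ nerveSpace U, S p = 1 := by
    intro p hp
    simp only [S, hfixu p hp]
    exact (mem_nerveSpace.1 hp).2.1
  refine ⟨{p | 0 < S p}, fun p => WithLp.toLp 2 fun i => u i p / S p,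
    isOpen_lt continuous_const hS, fun p hp => ?_, ?_, ?_, ?_⟩
  · simp [hfixS p hp]
  · refine (PiLp.continuous_toLp 2 _).comp_continuousOn (continuousOn_pi.2 fun i => ?_)
    exact (hu i).continuousOn.div hS.continuousOn fun p hp => (ne_of_gt hp)
  · intro p hp
    have hp' : 0 < S p := hp
    refine mem_nerveSpace.2 ⟨fun i => div_nonneg (hu0 i p) hp'.le, ?_, ?_⟩
    · simp only [← Finset.sum_div]
      exact div_self hp'.ne'
    · have hex : ∃ x, ∀ i ∈ Finset.univ.filter (fun i => t p < p i), x ∈ U i := by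
        by_contra hcon
        have hmem : Finset.univ.filter (fun i => t p < p i) ∈ N := by
          simpa [N] using hcon
        have hle := Finset.single_le_sum (f := fun σ => m σ p) (fun σ _ => hm0 σ p) hmem
        have hne : (Finset.univ.filter (fun i => t p < p i)).Nonempty := by
          by_contra h
          rw [Finset.not_nonempty_iff_eq_empty] at h
          have : S p = 0 := Finset.sum_eq_zero fun i _ => by
            refine max_eq_left (sub_nonpos.2 (not_lt.1 fun h' => ?_))
            have hi : i ∈ Finset.univ.filter (fun i => t p < p i) := by simpa using h'
            simp [h] at hi
          exact hp'.ne' this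
        have hlt : t p < m (Finset.univ.filter (fun i => t p < p i)) p := by
          simp only [m, hne, dif_pos]
          refine (Finset.lt_inf'_iff _).2 fun i hi => ?_
          exact (Finset.mem_filter.1 hi).2.trans_le (le_abs_self _)
        exact absurd hlt (not_lt.2 hle)
      obtain ⟨x, hx⟩ := hex
      refine ⟨x, fun i hi => hx i (Finset.mem_filter.2 ⟨Finset.mem_univ i, ?_⟩)⟩
      by_contra h
      refine hi ?_
      have : u i p = 0 := max_eq_left (by linarith)
      simp [this]
  · intro p hp
    ext i
    simp [hfixS p hp, hfixu p hp]

/-! ### Surjections onto nerves and approximate factorization -/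

/-- For a finite open cover of a nondegenerate continuum there is a subordinate partition of unity
whose canonical map to the nerve is onto. -/
theorem exists_map_onto_nerveSpace {X : Type*} [MetricSpace X] [CompactSpace X] [ConnectedSpace X]
    [Nontrivial X] {d : ℕ} {U : Fin d → Set X} (hU : ∀ i, IsOpen (U i)) (hcov : ⋃ i, U i = univ) :
    ∃ φ : X → EuclideanSpace ℝ (Fin d), Continuous φ ∧ range φ = nerveSpace U ∧
      ∀ x, φ x ∈ standardFace {i | x ∈ U i} := by
  classical
  obtain ⟨u, hu⟩ := PartitionOfUnity.exists_isSubordinate isClosed_univ U hU hcov.ge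
  let f : X → EuclideanSpace ℝ (Fin d) := fun x => WithLp.toLp 2 fun i => u i x
  have hf : Continuous f :=
    (PiLp.continuous_toLp 2 _).comp (continuous_pi fun i => (u i).continuous)
  have hfU : ∀ x, f x ∈ standardFace {i | x ∈ U i} := by
    intro x
    refine ⟨fun i => u.nonneg i x, ?_, fun i hi => hu i (subset_tsupport _ hi)⟩
    have h := u.sum_eq_one (mem_univ x)
    rwa [finsum_eq_sum_of_fintype] at h
  let s : X → Set (Fin d) := fun x => {i | x ∈ U i}
  -- There are only finitely many membership patterns, so the faces at points of `F` already fill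
  -- the nerve.
  obtain ⟨F, hF⟩ : ∃ F : Finset X, ∀ x, ∃ y ∈ F, s y = s x := by
    obtain ⟨T, -, hTs⟩ := exists_subset_bijOn univ s
    have hTfin : T.Finite := Finite.of_finite_image (toFinite _) hTs.injOn
    refine ⟨hTfin.toFinset, fun x => ?_⟩
    obtain ⟨y, hy, hyx⟩ := hTs.surjOn ⟨x, mem_univ x, rfl⟩
    exact ⟨y, hTfin.mem_toFinset.2 hy, hyx⟩
  obtain ⟨ε, hε, hball⟩ : ∃ ε > 0, ∀ y ∈ F, ∀ i, y ∈ U i → ball y ε ⊆ U i := by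
    have h : ∀ᶠ ε in 𝓝[>] (0 : ℝ), ∀ y ∈ F, ∀ i, y ∈ U i → ball y ε ⊆ U i := by
      refine (Finset.eventually_all F).2 fun y _ => eventually_all.2 fun i => ?_
      by_cases hy : y ∈ U i
      · obtain ⟨r, hr, hrU⟩ := Metric.isOpen_iff.1 (hU i) y hy
        filter_upwards [mem_nhdsWithin_of_mem_nhds (Iio_mem_nhds hr)] with ε hε _
        exact (ball_subset_ball (le_of_lt hε)).trans hrU
      · simp [hy]
    obtain ⟨ε, h1, h2⟩ := (h.and self_mem_nhdsWithin).exists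
    exact ⟨ε, h2, h1⟩
  obtain ⟨g, hg, hgf, hgC⟩ := exists_modification_covering_convex hf F
    (fun y => standardFace (s y)) (fun y => isCompact_standardFace _)
    (fun y => convex_standardFace _) (fun y => ⟨_, hfU y⟩) hε
  have hgU : ∀ x, g x ∈ standardFace {i | x ∈ U i} := by
    intro x
    rcases hgf x with h | ⟨y, hy, hxy, w, hw, h⟩
    · rw [h]; exact hfU x
    · refine (convex_standardFace _).segment_subset (hfU x) ?_ h
      exact standardFace_mono (fun i hi => hball y hy i hi hxy) hw
  refine ⟨g, hg, Subset.antisymm ?_ ?_, hgU⟩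
  · rintro _ ⟨x, rfl⟩
    exact mem_iUnion.2 ⟨x, hgU x⟩
  · refine iUnion_subset fun x p hp => ?_
    obtain ⟨y, hy, hyx⟩ := hF x
    exact hgC y hy (by rw [hyx]; exact hp)

theorem exists_ne_zero_of_mem_standardFace {d : ℕ} {s : Set (Fin d)}
    {p : EuclideanSpace ℝ (Fin d)} (hp : p ∈ standardFace s) : ∃ i ∈ s, p i ≠ 0 := by
  by_contra! h
  have h1 := hp.2.1
  rw [Finset.sum_eq_zero fun i _ => by_contra fun h' => h' (h i (hp.2.2 i h'))] at h1
  exact zero_ne_one h1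

/-- Nondegenerate continua map onto nerves of covers by arbitrarily small balls. -/
theorem exists_map_onto_nerveSpace_ball {X : Type*} [MetricSpace X] [CompactSpace X]
    [ConnectedSpace X] [Nontrivial X] {r : ℝ} (hr : 0 < r) :
    ∃ (d : ℕ) (a : Fin d → X) (φ : X → nerveSpace fun i => ball (a i) r), Continuous φ ∧
      Function.Surjective φ ∧
      ∀ x, (φ x : EuclideanSpace ℝ (Fin d)) ∈ standardFace {i | x ∈ ball (a i) r} := by
  obtain ⟨t, -, ht, hcov⟩ := finite_cover_balls_of_compact (isCompact_univ (X := X)) hr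
  let e := ht.toFinset.equivFin.symm
  obtain ⟨φ, hφ, hrange, hφU⟩ := exists_map_onto_nerveSpace
    (U := fun i => ball ((e i : X)) r) (fun i => isOpen_ball) (by
      refine eq_univ_of_forall fun x => ?_
      obtain ⟨y, hy, hxy⟩ := mem_iUnion₂.1 (hcov (mem_univ x))
      refine mem_iUnion.2 ⟨e.symm ⟨y, ht.mem_toFinset.2 hy⟩, ?_⟩
      simpa using hxy)
  refine ⟨_, fun i => (e i : X), fun x => ⟨φ x, hrange ▸ mem_range_self x⟩,
    hφ.subtype_mk _, ?_, hφU⟩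
  rintro ⟨p, hp⟩
  rw [← hrange] at hp
  obtain ⟨x, rfl⟩ := hp
  exact ⟨x, rfl⟩

/-- A nonzero coordinate of a common value would put both points in one open ball of radius `r`. -/
theorem map_ne_of_two_mul_le_dist {X : Type*} [MetricSpace X] {d : ℕ} {r : ℝ} {a : Fin d → X}
    {φ : X → EuclideanSpace ℝ (Fin d)}
    (hφ : ∀ x, φ x ∈ standardFace {i | x ∈ ball (a i) r}) {x y : X} (hxy : 2 * r ≤ dist x y) :
    φ x ≠ φ y := by
  intro h
  obtain ⟨i, hi, hne⟩ := exists_ne_zero_of_mem_standardFace (hφ x)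
  have hx : dist x (a i) < r := hi
  have hy : dist y (a i) < r := (hφ y).2.2 i (h ▸ hne)
  linarith [dist_triangle_right x y (a i)]

/-- The affine extension over a face of the standard simplex stays in a ball containing the
images of the vertices. -/
theorem sum_smul_mem_ball {d n : ℕ} {s : Set (Fin d)} {p : EuclideanSpace ℝ (Fin d)}
    (hp : p ∈ standardFace s) {v : Fin d → EuclideanSpace ℝ (Fin n)} {q : EuclideanSpace ℝ (Fin n)}
    {θ : ℝ} (hθ : 0 < θ) (hv : ∀ i ∈ s, dist (v i) q < θ) : ∑ i, p i • v i ∈ ball q θ := by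
  classical
  have h : ∑ i, p i • v i = ∑ i, p i • (if p i = 0 then q else v i) := by
    refine Finset.sum_congr rfl fun i _ => ?_
    split_ifs with h
    · simp [h]
    · rfl
  rw [h]
  refine (convex_ball q θ).sum_mem (fun i _ => hp.1 i) hp.2.1 fun i _ => ?_
  split_ifs with h
  · exact mem_ball_self hθ
  · exact hv i (hp.2.2 i h)

/-- A map of a nondegenerate continuum onto a nerve factors approximately, through arbitrarily
fine nerves, with surjective factors. -/
theorem exists_approximate_factorization {X : Type*} [MetricSpace X] [CompactSpace X]
    [ConnectedSpace X] {A : Type*} {d : ℕ} {U : Fin d → Set A} {φ : X → nerveSpace U}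
    (hφ : Continuous φ) (hφs : Function.Surjective φ) {η : ℝ} (hη : 0 < η) {ε : ℝ} (hε : 0 < ε)
    (hX : ∃ a b : X, ε ≤ dist a b) :
    ∃ (d' : ℕ) (U' : Fin d' → Set X) (φ' : X → nerveSpace U'), Continuous φ' ∧
      Function.Surjective φ' ∧ (∀ x y, ε ≤ dist x y → φ' x ≠ φ' y) ∧
      ∃ ψ : nerveSpace U' → nerveSpace U, Continuous ψ ∧ Function.Surjective ψ ∧
        ∀ x, dist (ψ (φ' x)) (φ x) < η := by
  obtain ⟨a₀, b₀, hab⟩ := hX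
  have : Nontrivial X := ⟨a₀, b₀, fun h => by rw [h, dist_self] at hab; linarith⟩
  have hPcomp : IsCompact (nerveSpace U) := by
    have := hφs.compactSpace hφ
    exact isCompact_iff_compactSpace.2 this
  obtain ⟨O, ρ, hO, hPO, hρ, hρP, hρfix⟩ := exists_retraction_nerveSpace U
  obtain ⟨η₁, hη₁, hη₁O, hη₁ρ⟩ : ∃ η₁ > 0, (∀ q ∈ nerveSpace U, ∀ p, dist p q < η₁ → p ∈ O) ∧
      ∀ q ∈ nerveSpace U, ∀ p, dist p q < η₁ → dist (ρ p) q < η := by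
    obtain ⟨δ₁, hδ₁, h₁⟩ := hPcomp.exists_thickening_subset_open hO hPO
    have h₂ := hPcomp.uniformContinuousAt_of_continuousAt ρ
      (fun q hq => hρ.continuousAt (hO.mem_nhds (hPO hq))) (dist_mem_uniformity hη)
    obtain ⟨δ₂, hδ₂, h₂⟩ := Metric.mem_uniformity_dist.1 h₂
    refine ⟨min δ₁ δ₂, lt_min hδ₁ hδ₂, fun q hq p hp => h₁ ?_, fun q hq p hp => ?_⟩
    · exact mem_thickening_iff.2 ⟨q, hq, hp.trans_le (min_le_left _ _)⟩
    · rw [dist_comm] at hp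
      have h := h₂ (hp.trans_le (min_le_right _ _)) hq
      rw [mem_ofPred_eq, hρfix q hq, dist_comm] at h
      exact h
  -- Budget: θ between `f` and `φ`, and 3θ for the modification of `f` (radius 2θ plus oscillation
  -- θ).
  obtain ⟨θ, hθ, hθη⟩ : ∃ θ > 0, 4 * θ < η₁ := ⟨η₁ / 8, by positivity, by linarith⟩
  obtain ⟨μ, hμ, hφμ⟩ := Metric.uniformContinuous_iff.1
    (CompactSpace.uniformContinuous_of_continuous hφ) θ hθ
  obtain ⟨r, hr, hrμ, hrε⟩ : ∃ r > 0, r ≤ μ ∧ 2 * r ≤ ε :=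
    ⟨min μ (ε / 2), lt_min hμ (by positivity), min_le_left _ _,
      by linarith [min_le_right μ (ε / 2)]⟩
  obtain ⟨d', a, φ', hφ', hφ's, hφ'U⟩ := exists_map_onto_nerveSpace_ball (X := X) hr
  have hsep : ∀ x y, ε ≤ dist x y → φ' x ≠ φ' y := fun x y h heq =>
    map_ne_of_two_mul_le_dist (φ := fun x => (φ' x : EuclideanSpace ℝ (Fin d'))) hφ'U
      (hrε.trans h) (congrArg Subtype.val heq)
  refine ⟨d', _, φ', hφ', hφ's, hsep, ?_⟩
  have : CompactSpace (nerveSpace fun i => ball (a i) r) := hφ's.compactSpace hφ'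
  have : ConnectedSpace (nerveSpace fun i => ball (a i) r) := hφ's.connectedSpace hφ'
  have : Nontrivial (nerveSpace fun i => ball (a i) r) := ⟨_, _, hsep _ _ hab⟩
  -- The affine extension of the vertex assignment `a j ↦ φ (a j)`; it may leave the target nerve,
  -- hence the retraction `ρ`.
  let f : (nerveSpace fun i => ball (a i) r) → EuclideanSpace ℝ (Fin d) :=
    fun p => ∑ j, (p : EuclideanSpace ℝ (Fin d')) j • (φ (a j) : EuclideanSpace ℝ (Fin d))
  have hf : Continuous f := by
    refine continuous_finsetSum _ fun j _ => ?_
    fun_prop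
  have hfφ : ∀ (z : nerveSpace fun i => ball (a i) r) (x : X),
      (z : EuclideanSpace ℝ (Fin d')) ∈ standardFace {i | x ∈ ball (a i) r} →
      dist (f z) (φ x) < θ := by
    intro z x hz
    refine sum_smul_mem_ball hz hθ fun i hi => ?_
    refine hφμ ?_
    rw [dist_comm]
    exact (mem_ball.1 hi).trans_le hrμ
  obtain ⟨δ, hδ, hfδ⟩ := Metric.uniformContinuous_iff.1
    (CompactSpace.uniformContinuous_of_continuous hf) θ hθ
  obtain ⟨t, -, ht, hcov⟩ := finite_cover_balls_of_compact
    (isCompact_univ (X := nerveSpace fun i => ball (a i) r)) hδ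
  -- The centres form a δ-net, so these balls of radius 2θ cover the target nerve: `φ x` is within θ
  -- of `f (φ' x)`, itself within θ of some `f y`.
  obtain ⟨g, hg, hgf, hgC⟩ := exists_modification_covering_convex hf ht.toFinset
    (fun y => closedBall (f y) (2 * θ)) (fun y => isCompact_closedBall _ _)
    (fun y => convex_closedBall _ _) (fun y => nonempty_closedBall.2 (by positivity)) hδ
  have hgf' : ∀ z, dist (g z) (f z) ≤ 3 * θ := by
    intro z
    rcases hgf z with h | ⟨y, -, hzy, w, hw, h⟩
    · rw [h, dist_self]; positivity
    · refine (convex_closedBall (f z) (3 * θ)).segment_subset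
        (mem_closedBall_self (by positivity)) ?_ h
      have h1 := hfδ hzy
      have h2 := mem_closedBall.1 hw
      have h3 := dist_triangle_right w (f z) (f y)
      exact mem_closedBall.2 (by linarith)
  have hgφ : ∀ (z : nerveSpace fun i => ball (a i) r) (x : X),
      (z : EuclideanSpace ℝ (Fin d')) ∈ standardFace {i | x ∈ ball (a i) r} →
      dist (g z) (φ x) < η₁ := by
    intro z x hz
    linarith [dist_triangle (g z) (f z) (φ x), hgf' z, hfφ z x hz]
  have hgO : ∀ z, g z ∈ O := by
    intro z
    obtain ⟨x, hx⟩ := mem_iUnion.1 z.2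
    exact hη₁O _ (φ x).2 _ (hgφ z x hx)
  refine ⟨fun z => ⟨ρ (g z), hρP _ (hgO z)⟩, (hρ.comp_continuous hg hgO).subtype_mk _, ?_, ?_⟩
  · intro q
    obtain ⟨x, rfl⟩ := hφs q
    obtain ⟨y, hy, hxy⟩ := mem_iUnion₂.1 (hcov (mem_univ (φ' x)))
    have h1 := hfφ _ x (hφ'U x)
    have h2 := hfδ (mem_ball.1 hxy)
    have h3 := dist_triangle_left (φ x : EuclideanSpace ℝ (Fin d)) (f y) (f (φ' x))
    obtain ⟨z, hz⟩ := hgC y (ht.mem_toFinset.2 hy) (mem_closedBall.2 (by linarith))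
    exact ⟨z, Subtype.ext (by simp [hz, hρfix _ (φ x).2])⟩
  · intro x
    exact hη₁ρ _ (φ x).2 _ (hgφ _ x (hφ'U x))

/-! ### Bonding maps and the approximation theorem -/

theorem bondingMap_proj {Y : ℕ → Type*} (ψ : ∀ n, Y (n + 1) → Y n) (p : inverseLimit ψ) {n m : ℕ}
    (h : n ≤ m) : bondingMap ψ h (inverseLimitProj ψ m p) = inverseLimitProj ψ n p := by
  induction m, h using Nat.le_induction with
  | base => rw [bondingMap_self]; rfl
  | succ m hm ih =>
    rw [bondingMap_succ ψ hm, Function.comp_apply, ← ih]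
    exact congrArg _ (p.2 m).symm

theorem continuous_bondingMap {Y : ℕ → Type*} [∀ n, TopologicalSpace (Y n)]
    {ψ : ∀ n, Y (n + 1) → Y n} (hψ : ∀ n, Continuous (ψ n)) {n m : ℕ} (h : n ≤ m) :
    Continuous (bondingMap ψ h) := by
  induction m, h using Nat.le_induction with
  | base => rw [bondingMap_self]; exact continuous_id
  | succ m hm ih => rw [bondingMap_succ ψ hm]; exact ih.comp (hψ m)

theorem apply_bondingMap {Y : ℕ → Type*} (ψ : ∀ n, Y (n + 1) → Y n) {n m : ℕ} (h : n + 1 ≤ m)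
    (p : Y m) : ψ n (bondingMap ψ h p) = bondingMap ψ (Nat.le_of_succ_le h) p := by
  induction m, h using Nat.le_induction with
  | base => rw [bondingMap_self, bondingMap_succ ψ le_rfl, bondingMap_self]; rfl
  | succ m hm ih =>
    rw [bondingMap_succ ψ hm, bondingMap_succ ψ (Nat.le_of_succ_le hm)]
    exact ih _

/-- Approximation theorem: surjections of a compact space onto the terms of an inverse sequence
which commute with the bonding maps up to small errors, and separate points increasingly well,
give a homeomorphism onto the inverse limit. -/
theorem exists_homeomorph_inverseLimit {X : Type*} [MetricSpace X] [CompactSpace X]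
    {Y : ℕ → Type*} [∀ n, MetricSpace (Y n)] [∀ n, CompactSpace (Y n)]
    {ψ : ∀ n, Y (n + 1) → Y n} (hψ : ∀ n, Continuous (ψ n))
    {φ : ∀ n, X → Y n} (hφ : ∀ n, Continuous (φ n)) (hφs : ∀ n, Function.Surjective (φ n))
    {c : ℕ → ℝ} (hc : ∀ n, 0 < c n)
    (happrox : ∀ (k n : ℕ) (h : k ≤ n) (x : X), c k *
      dist (bondingMap ψ h (φ n x)) (bondingMap ψ (Nat.le_succ_of_le h) (φ (n + 1) x))
        ≤ (1 / 2) ^ n)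
    {ε : ℕ → ℝ} (hε : Tendsto ε atTop (𝓝 0))
    (hsep : ∀ k x y, ε k ≤ dist x y → 4 < c k * dist (φ k x) (φ k y)) :
    ∃ e : inverseLimit ψ ≃ₜ X, ∀ p q k, ε k ≤ dist (e p) (e q) →
      inverseLimitProj ψ k p ≠ inverseLimitProj ψ k q := by
  let s : ∀ k, X → ℕ → Y k := fun k x j => bondingMap ψ (Nat.le_add_right k j) (φ (k + j) x)
  have hs : ∀ k x j, dist (s k x j) (s k x (j + 1)) ≤ (1 / c k) / 2 ^ k / 2 ^ j := by
    intro k x j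
    have h := happrox k (k + j) (Nat.le_add_right k j) x
    rw [← le_div_iff₀' (hc k)] at h
    refine h.trans (le_of_eq ?_)
    rw [pow_add, one_div_pow, one_div_pow]
    have := (hc k).ne'
    field_simp
  have hs' : ∀ k x j, dist (s k x j) (s k x (j + 1)) ≤ (2 * ((1 / c k) / 2 ^ k)) / 2 / 2 ^ j := by
    intro k x j
    convert! hs k x j using 2
    ring
  choose Φ hΦ using fun k x => cauchySeq_tendsto_of_complete (cauchySeq_of_le_geometric_two (hs' k x))
  have hbound : ∀ k x j, dist (s k x j) (Φ k x) ≤ (2 * ((1 / c k) / 2 ^ k)) / 2 ^ j :=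
    fun k x j => dist_le_of_le_geometric_two_of_tendsto (hs' k x) (hΦ k x) j
  have hgeo : ∀ k, Tendsto (fun j : ℕ => (2 * ((1 / c k) / 2 ^ k)) / 2 ^ j) atTop (𝓝 0) := by
    intro k
    have h := (tendsto_pow_atTop_nhds_zero_of_lt_one (r := (1 / 2 : ℝ)) (by norm_num)
      (by norm_num)).const_mul (2 * ((1 / c k) / 2 ^ k))
    simpa [div_eq_mul_inv] using h
  have hΦc : ∀ k, Continuous (Φ k) := by
    intro k
    have hu : TendstoUniformly (fun j x => s k x j) (Φ k) atTop := by
      rw [Metric.tendstoUniformly_iff]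
      intro δ hδ
      filter_upwards [(hgeo k).eventually_lt_const hδ] with j hj x
      rw [dist_comm]
      exact (hbound k x j).trans_lt hj
    exact hu.continuous (Eventually.of_forall fun j =>
      (continuous_bondingMap hψ _).comp (hφ _)).frequently
  have hΦψ : ∀ k x, Φ k x = ψ k (Φ (k + 1) x) := by
    intro k x
    refine tendsto_nhds_unique ((hΦ k x).comp (tendsto_add_atTop_nat 1)) ?_
    refine (((hψ k).tendsto _).comp (hΦ (k + 1) x)).congr fun j => ?_
    simp only [Function.comp_apply, s]
    have key : ∀ (m m' : ℕ) (h : k ≤ m) (h' : k ≤ m'), m = m' →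
        bondingMap ψ h (φ m x) = bondingMap ψ h' (φ m' x) := by
      rintro m _ h h' rfl; rfl
    exact (apply_bondingMap ψ (Nat.le_add_right (k + 1) j) _).trans
      (key (k + 1 + j) (k + (j + 1)) (by omega) (by omega) (by omega))
  -- The geometric errors total at most 2 in scaled distance, so two of them cannot absorb the
  -- separation 4 of `hsep`.
  have hclose : ∀ k x, c k * dist (φ k x) (Φ k x) ≤ 2 := by
    intro k x
    have h := hbound k x 0
    have h0 : s k x 0 = φ k x := by
      simp only [s, Nat.add_zero]
      exact congrFun (bondingMap_self ψ k) _
    rw [h0, pow_zero, div_one] at h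
    have h2 : c k * dist (φ k x) (Φ k x) ≤ c k * (2 * ((1 / c k) / 2 ^ k)) :=
      mul_le_mul_of_nonneg_left h (hc k).le
    refine h2.trans ?_
    have h3 : c k * (2 * ((1 / c k) / 2 ^ k)) = 2 / 2 ^ k := by
      have := (hc k).ne'
      field_simp
    rw [h3]
    exact div_le_self zero_le_two (one_le_pow₀ one_le_two)
  have hsepΦ : ∀ k x y, ε k ≤ dist x y → Φ k x ≠ Φ k y := by
    intro k x y hxy heq
    have h1 := hsep k x y hxy
    have h2 := hclose k x
    have h3 := hclose k y
    rw [← heq] at h3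
    have h4 := mul_le_mul_of_nonneg_left (dist_triangle_right (φ k x) (φ k y) (Φ k x)) (hc k).le
    linarith
  let G : X → inverseLimit ψ := fun x => ⟨fun k => Φ k x, fun k => hΦψ k x⟩
  have hG : Continuous G := (continuous_pi hΦc).subtype_mk _
  have hGinj : Function.Injective G := by
    intro x y hxy
    by_contra hne
    obtain ⟨k, hk⟩ := (hε.eventually_lt_const (dist_pos.2 hne)).exists
    exact hsepΦ k x y hk.le (congrFun (congrArg Subtype.val hxy) k)
  have hGsurj : Function.Surjective G := by
    intro p
    -- `x n` realizes the n-th coordinate of `p` exactly, hence `Φ k (x n)` tends to the k-th one; a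
    -- cluster point of `x` is then a preimage.
    choose x hx using fun n => hφs n (p.1 n)
    obtain ⟨y, -, τ, hτ, hy⟩ := isCompact_univ.tendsto_subseq (fun n => mem_univ (x n))
    refine ⟨y, Subtype.ext (funext fun k => ?_)⟩
    have h1 : Tendsto (fun n => Φ k (x (τ n))) atTop (𝓝 (Φ k y)) :=
      ((hΦc k).tendsto y).comp hy
    have h2 : Tendsto (fun n => Φ k (x n)) atTop (𝓝 (p.1 k)) := by
      rw [← tendsto_add_atTop_iff_nat k, tendsto_iff_dist_tendsto_zero]
      refine squeeze_zero (fun _ => dist_nonneg) (fun j => ?_) (hgeo k)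
      have h := hbound k (x (j + k)) j
      have h3 : s k (x (j + k)) j = p.1 k := by
        have key : ∀ (m : ℕ) (h : k ≤ m), m = j + k →
            bondingMap ψ h (φ m (x (j + k))) = p.1 k := by
          rintro m h rfl
          rw [hx]
          exact bondingMap_proj ψ p h
        exact key _ _ (by omega)
      rwa [h3, dist_comm] at h
    exact tendsto_nhds_unique h1 (h2.comp hτ.tendsto_atTop)
  let e : X ≃ₜ inverseLimit ψ :=
    hG.homeoOfEquivCompactToT2 (f := Equiv.ofBijective G ⟨hGinj, hGsurj⟩)
  refine ⟨e.symm, fun p q k h heq => hsepΦ k _ _ h ?_⟩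
  have hp : ∀ p, Φ k (e.symm p) = inverseLimitProj ψ k p := fun p =>
    congrFun (congrArg Subtype.val (e.apply_symm_apply p)) k
  rw [hp, hp, heq]

/-! ### Recursive construction of the inverse sequence -/

/-- Pairs at distance at least `ε` form a compact set, so the image distance has a positive minimum
there unless the set is empty. -/
theorem exists_separation_constant {X Y : Type*} [MetricSpace X] [CompactSpace X] [MetricSpace Y]
    {φ : X → Y} (hφ : Continuous φ) {ε : ℝ} (hsep : ∀ x y, ε ≤ dist x y → φ x ≠ φ y) :
    ∃ c > 0, ∀ x y, ε ≤ dist x y → 4 < c * dist (φ x) (φ y) := by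
  have hK : IsCompact {p : X × X | ε ≤ dist p.1 p.2} :=
    (isClosed_le continuous_const continuous_dist).isCompact
  rcases {p : X × X | ε ≤ dist p.1 p.2}.eq_empty_or_nonempty with he | hne
  · exact ⟨1, one_pos, fun x y h => absurd (he ▸ h : (x, y) ∈ (∅ : Set (X × X))) (notMem_empty _)⟩
  · obtain ⟨p, hp, hmin⟩ := hK.exists_isMinOn hne
      (f := fun p => dist (φ p.1) (φ p.2)) (by fun_prop)
    have hpos : 0 < dist (φ p.1) (φ p.2) := dist_pos.2 (hsep _ _ hp)
    refine ⟨5 / dist (φ p.1) (φ p.2), by positivity, fun x y h => ?_⟩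
    have h1 : dist (φ p.1) (φ p.2) ≤ dist (φ x) (φ y) := hmin (a := (x, y)) h
    have h2 : 5 ≤ 5 / dist (φ p.1) (φ p.2) * dist (φ x) (φ y) := by
      rw [div_mul_eq_mul_div, le_div_iff₀ hpos]
      linarith
    linarith

theorem exists_gauge_modulus {Y : Type*} [MetricSpace Y] [CompactSpace Y] {D : Y → Y → ℝ}
    (hD : Continuous fun p : Y × Y => D p.1 p.2) (hD0 : ∀ p, D p p = 0) {δ : ℝ} (hδ : 0 < δ) :
    ∃ η > 0, ∀ p q, dist p q < η → D p q ≤ δ := by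
  obtain ⟨η, hη, h⟩ := Metric.uniformContinuous_iff.1
    (CompactSpace.uniformContinuous_of_continuous hD) δ hδ
  refine ⟨η, hη, fun p q hpq => ?_⟩
  have h1 : dist (p, q) (q, q) < η := by
    rw [Prod.dist_eq, dist_self]
    exact max_lt hpq hη
  have h2 := h h1
  simp only [hD0, Real.dist_eq, sub_zero] at h2
  exact (le_abs_self _).trans h2.le

/-- A surjection of `X` onto a nerve separating points at distance at least `ε`, with a gauge
controlling the errors that will be allowed in later approximations. -/
structure NerveStage (X : Type*) [MetricSpace X] (ε : ℝ) where
  dim : ℕ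
  cover : Fin dim → Set X
  map : X → nerveSpace cover
  continuous_map : Continuous map
  surjective_map : Function.Surjective map
  scale : ℝ
  scale_pos : 0 < scale
  separates : ∀ x y, ε ≤ dist x y → 4 < scale * dist (map x) (map y)
  gauge : nerveSpace cover → nerveSpace cover → ℝ
  continuous_gauge : Continuous fun p : nerveSpace cover × nerveSpace cover => gauge p.1 p.2
  gauge_self : ∀ p, gauge p p = 0
  le_gauge : ∀ p q, scale * dist p q ≤ gauge p q

namespace NerveStage

theorem exists_initial (X : Type*) [MetricSpace X] [CompactSpace X] [ConnectedSpace X]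
    [Nontrivial X] {ε : ℝ} (hε : 0 < ε) : Nonempty (NerveStage X ε) := by
  obtain ⟨d, a, φ, hφ, hφs, hφU⟩ := exists_map_onto_nerveSpace_ball (X := X) (half_pos hε)
  obtain ⟨c, hc, hsep⟩ := exists_separation_constant hφ (ε := ε) fun x y h heq =>
    map_ne_of_two_mul_le_dist (φ := fun x => (φ x : EuclideanSpace ℝ (Fin d))) hφU
      (by linarith) (congrArg Subtype.val heq)
  exact ⟨⟨d, _, φ, hφ, hφs, c, hc, hsep, fun p q => c * dist p q, by fun_prop, by simp,
    fun p q => le_rfl⟩⟩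

/-- The new gauge is the maximum of the scaled metric and the pullback of the old gauge. Inductively
it dominates the scaled distances of images in all earlier stages, so one bound `δ` on the newest
error controls them all. -/
theorem exists_next {X : Type*} [MetricSpace X] [CompactSpace X] [ConnectedSpace X] {ε : ℝ}
    (S : NerveStage X ε) {ε' : ℝ} (hε' : 0 < ε') (hX : ∃ a b : X, ε' ≤ dist a b) {δ : ℝ}
    (hδ : 0 < δ) :
    ∃ (S' : NerveStage X ε') (ψ : nerveSpace S'.cover → nerveSpace S.cover), Continuous ψ ∧
      Function.Surjective ψ ∧ (∀ x, S.gauge (S.map x) (ψ (S'.map x)) ≤ δ) ∧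
      ∀ p q, S.gauge (ψ p) (ψ q) ≤ S'.gauge p q := by
  have : CompactSpace (nerveSpace S.cover) := S.surjective_map.compactSpace S.continuous_map
  obtain ⟨η, hη, hgauge⟩ := exists_gauge_modulus S.continuous_gauge S.gauge_self hδ
  obtain ⟨d, U, φ, hφ, hφs, hne, ψ, hψ, hψs, happrox⟩ :=
    exists_approximate_factorization S.continuous_map S.surjective_map hη hε' hX
  obtain ⟨c, hc, hsep⟩ := exists_separation_constant hφ hne
  have hψ2 : Continuous fun p : nerveSpace U × nerveSpace U => S.gauge (ψ p.1) (ψ p.2) :=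
    S.continuous_gauge.comp ((hψ.comp continuous_fst).prodMk (hψ.comp continuous_snd))
  refine ⟨⟨d, U, φ, hφ, hφs, c, hc, hsep, fun p q => max (c * dist p q) (S.gauge (ψ p) (ψ q)),
    (by fun_prop : Continuous fun p : nerveSpace U × nerveSpace U => c * dist p.1 p.2).max hψ2,
    fun p => by simp [S.gauge_self], fun p q => le_max_left _ _⟩, ψ, hψ, hψs, fun x => ?_,
    fun p q => le_max_right _ _⟩
  exact hgauge _ _ (by rw [dist_comm]; exact happrox x)

end NerveStage

/-- Every nondegenerate continuum is the inverse limit of connected polyhedra with surjective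
bonding maps; all the projections may be required to separate points that are at distance at
least `ε`. -/
theorem exists_polyhedralInverseSequence {X : Type*} [MetricSpace X] [CompactSpace X]
    [ConnectedSpace X] {ε : ℝ} (hε : 0 < ε) (hX : ∃ a b : X, ε ≤ dist a b) :
    ∃ (S : PolyhedralInverseSequence) (e : S.limit ≃ₜ X), ∀ p q k, ε ≤ dist (e p) (e q) →
      inverseLimitProj (X := fun l => S.P l) S.f k p ≠
        inverseLimitProj (X := fun l => S.P l) S.f k q := by
  obtain ⟨a, b, hab⟩ := hX
  have : Nontrivial X := ⟨a, b, fun h => by rw [h, dist_self] at hab; linarith⟩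
  -- Tending to 0 makes the limit map injective; staying at most `ε` makes every projection, even
  -- the first, separate at `ε`.
  let r : ℕ → ℝ := fun n => ε * (1 / 2) ^ n
  have hr : ∀ n, 0 < r n := fun n => by positivity
  have hrε : ∀ n, r n ≤ ε := fun n =>
    mul_le_of_le_one_right hε.le (pow_le_one₀ (by norm_num) (by norm_num))
  have hr0 : Tendsto r atTop (𝓝 0) := by
    simpa [r] using (tendsto_pow_atTop_nhds_zero_of_lt_one (r := (1 / 2 : ℝ)) (by norm_num)
      (by norm_num)).const_mul ε
  choose next ψ hψ hψs happrox hgauge using fun (n : ℕ) (S : NerveStage X (r n)) =>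
    S.exists_next (hr (n + 1)) ⟨a, b, (hrε (n + 1)).trans hab⟩
      (δ := (1 / 2) ^ n) (by positivity)
  let S : ∀ n, NerveStage X (r n) := fun n =>
    Nat.rec (NerveStage.exists_initial X (hr 0)).some (fun n T => next n T) n
  let Y : ℕ → Type := fun n => nerveSpace (S n).cover
  let _ : ∀ n, MetricSpace (Y n) := fun n =>
    inferInstanceAs (MetricSpace (nerveSpace (S n).cover))
  have _ : ∀ n, CompactSpace (Y n) := fun n =>
    (S n).surjective_map.compactSpace (S n).continuous_map
  let f : ∀ n, Y (n + 1) → Y n := fun n => ψ n (S n)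
  have hf : ∀ n, Continuous (f n) := fun n => hψ n (S n)
  have hbond : ∀ (k n : ℕ) (h : k ≤ n) (p q : Y n),
      (S k).scale * dist (bondingMap f h p) (bondingMap f h q) ≤ (S n).gauge p q := by
    intro k n h
    induction n, h using Nat.le_induction with
    | base => intro p q; rw [bondingMap_self]; exact (S k).le_gauge p q
    | succ n hn ih =>
      intro p q
      rw [bondingMap_succ f hn]
      exact (ih _ _).trans (hgauge n (S n) p q)
  obtain ⟨e, he⟩ := exists_homeomorph_inverseLimit (X := X) (Y := Y) (ψ := f) hf
    (φ := fun n => (S n).map) (fun n => (S n).continuous_map) (fun n => (S n).surjective_map)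
    (c := fun n => (S n).scale) (fun n => (S n).scale_pos)
    (fun k n h x => by
      rw [bondingMap_succ f h]
      exact (hbond k n h _ _).trans (happrox n (S n) x))
    hr0 (fun k => (S k).separates)
  refine ⟨⟨fun n => (S n).dim, fun n => nerveSpace (S n).cover,
    fun n => isPolyhedron_nerveSpace _, fun n => ?_, f, hf, fun n => hψs n (S n)⟩, e,
    fun p q k h => he p q k ((hrε k).trans h)⟩
  exact isConnected_iff_connectedSpace.2
    ((S n).surjective_map.connectedSpace (S n).continuous_map)

/-! ### Transformations and coincidences of projections -/

theorem mem_transformation_of_proj_eq {Y : ℕ → Type*} {ψ : ∀ n, Y (n + 1) → Y n}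
    {g : inverseLimit ψ → inverseLimit ψ} {n m : ℕ} (h : n ≤ m) {p : inverseLimit ψ}
    (hp : inverseLimitProj ψ n (g p) = inverseLimitProj ψ n p) :
    bondingMap ψ h (inverseLimitProj ψ m p) ∈
      transformation ψ ψ g n m (inverseLimitProj ψ m p) :=
  ⟨g p, ⟨p, rfl, rfl⟩, by rw [hp, bondingMap_proj]⟩

theorem exists_proj_eq_of_mem_transformation {Y : ℕ → Type*} {ψ : ∀ n, Y (n + 1) → Y n}
    {g : inverseLimit ψ → inverseLimit ψ} {n m : ℕ} (h : n ≤ m) {x : Y m}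
    (hx : bondingMap ψ h x ∈ transformation ψ ψ g n m x) :
    ∃ p, inverseLimitProj ψ n (g p) = inverseLimitProj ψ n p := by
  obtain ⟨_, ⟨p, rfl, rfl⟩, hp⟩ := hx
  exact ⟨p, by rw [hp, bondingMap_proj]⟩

end

theorem mainTheorem2 (X : Type*) [MetricSpace X] [CompactSpace X] [ConnectedSpace X] :
    List.TFAE [
      ¬ HasFixedPointProperty X,
      ∃ S : PolyhedralInverseSequence, Nonempty (S.limit ≃ₜ X) ∧
        ∃ g : S.limit → S.limit, Continuous g ∧
          ∃ (n m : ℕ) (h : n ≤ m), ∀ x : S.P m, S.bond h x ∉ S.T n m g x,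
      ∃ S : PolyhedralInverseSequence, Nonempty (S.limit ≃ₜ X) ∧
        ∃ g : S.limit → S.limit, Continuous g ∧
          ∀ (n m : ℕ) (h : n ≤ m), ∀ x : S.P m, S.bond h x ∉ S.T n m g x] := by
  tfae_have 1 → 3 := by
    intro hX
    simp only [HasFixedPointProperty, not_forall, not_exists] at hX
    -- The least displacement is attained by compactness, so it is positive and serves as `ε`; the
    -- pair `f x₀`, `x₀` shows that `X` is nondegenerate.
    obtain ⟨f, hf, hfix⟩ := hX
    obtain ⟨x₀, -, hmin⟩ := isCompact_univ.exists_isMinOn (Set.univ_nonempty (α := X))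
      (f := fun x => dist (f x) x) (by fun_prop)
    obtain ⟨S, e, he⟩ := exists_polyhedralInverseSequence (dist_pos.2 (hfix x₀)) ⟨f x₀, x₀, le_rfl⟩
    refine ⟨S, ⟨e⟩, fun p => e.symm (f (e p)), by fun_prop, fun n m h x hx => ?_⟩
    obtain ⟨p, hp⟩ := exists_proj_eq_of_mem_transformation h hx
    refine he _ _ n ?_ hp
    rw [e.apply_symm_apply]
    exact hmin (Set.mem_univ (e p))
  tfae_have 3 → 2 := fun ⟨S, hS, g, hg, h⟩ => ⟨S, hS, g, hg, 0, 0, le_rfl, h 0 0 le_rfl⟩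
  tfae_have 2 → 1 := by
    rintro ⟨S, ⟨e⟩, g, hg, n, m, h, hT⟩ hX
    obtain ⟨x, hx⟩ := hX (fun x => e (g (e.symm x))) (by fun_prop)
    have hfix : g (e.symm x) = e.symm x := e.injective (by rw [hx, e.apply_symm_apply])
    exact hT (inverseLimitProj (X := fun l => S.P l) S.f m (e.symm x))
      (mem_transformation_of_proj_eq (Y := fun l => S.P l) (ψ := S.f) (g := g) h
        (congrArg _ hfix))
  tfae_finish
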